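/- Consider infinite streams $\sigma=(\sigma_1,\sigma_2,\dots)$ of insertions and deletions of elements of $[N]=\{1,\dots,N\}$. Let $m_i^{(n)}(\sigma)$ be the number of insertions minus the number of deletions of $i$ among the first $n$ updates. Call $\sigma$ valid if $m_i^{(n)}(\sigma)\ge 0$ for all $i$ and $n$ (only present elements are deleted), and let $F_k^{(n)}(\sigma)=\sum_{i=1}^N \bigl(m_i^{(n)}(\sigma)\bigr)^k$. A randomized one-pass streaming algorithm over $[N]$ keeps a bit string, its memory; at each update the new memory is determined by the old memory, the update, the number of updates read so far, and random coins, and after each update a real estimate is computed from the memory, the number of updates read so far, and the random coins. (Computing time, the step counter and the random coins are not charged.) For $0<\delta<1/2$ it is asymptotically exact for $F_k$ under insertions and deletions, with failure probability $\delta$, if for every valid infinite stream $\sigma$ there is a sequence $\varepsilon_n\to 0$ such that for every $n$ with $F_k^{(n)}(\sigma)\neq 0$ the estimate $\tilde F^{(n)}$ after $n$ updates satisfies $$\Pr\left[\,\left|\frac{\tilde F^{(n)}}{F_k^{(n)}(\sigma)}-1\right|\le \varepsilon_n\right]\ \ge\ 1-\delta .$$ No bound on the memory is part of this definition. **Theorem.**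 For every integer $k\ge 2$, any asymptotically exact streaming algorithm for estimating $F_k$ under insertions and deletions requires $\Omega(n)$ bits of memory. Precisely: for every integer $k\ge 2$ and every $0<\delta<1/2$ there are $c>0$ and $n_0$ such that for all $n\ge n_0$ and $N\ge n$, and for every streaming algorithm over $[N]$ that is asymptotically exact for $F_k$ under insertions and deletions with failure probability $\delta$: if $s\in\mathbb{N}$ is such that, on every valid stream, the memory after $n$ updates almost surely has at most $s$ bits, then $s\ge c\,n$. -/

import Mathlib

open MeasureTheory Filter Topology

namespace DynamicStream

/-- One item of a dynamic stream over the universe `[N]`, modelled as `Fin N`: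
the insertion or the deletion of one copy of an element. -/
inductive Update (N : ℕ) : Type
  | ins : Fin N → Update N
  | del : Fin N → Update N

/-- The change that an update makes to the multiplicity of the element `i`. -/
def Update.delta {N : ℕ} : Update N → Fin N → ℤ
  | .ins a, i => if i = a then 1 else 0
  | .del a, i => if i = a then -1 else 0

/-- The multiplicity `m_i` of `i` after the first `n` updates of the infinite stream `σ`
(number of insertions of `i` minus number of deletions of `i`). -/
def freq {N : ℕ} (σ : ℕ → Update N) (n : ℕ) (i : Fin N) : ℤ :=
  ∑ j ∈ Finset.range n, (σ j).delta i

/-- A stream is valid if only elements that are present get deleted,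
so that no multiplicity ever becomes negative. -/
def Valid {N : ℕ} (σ : ℕ → Update N) : Prop :=
  ∀ n i, 0 ≤ freq σ n i

/-- The frequency moment `F_k = ∑ i, m_i ^ k` after the first `n` updates. -/
def moment {N : ℕ} (k : ℕ) (σ : ℕ → Update N) (n : ℕ) : ℝ :=
  ∑ i, (freq σ n i : ℝ) ^ k

/-- A randomized one-pass streaming algorithm for dynamic streams over `[N]` with real output.

The memory content between two updates is a bit string. The next memory content depends only on
the current one, on the update being read, on the number `t` of updates read before, and on the
random source `ω`; the output depends only on the memory content, on `t` and on `ω`.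
The model is information-theoretic: there is no restriction on computing time, and neither the
working space within a step, nor the counter `t`, nor the random source is charged as memory.
In particular algorithms that toss fresh coins at every step and have to store the coins they
want to reuse are included. -/
structure Algorithm (N : ℕ) (Ω : Type*) [MeasurableSpace Ω] where
  init : Ω → List Bool
  step : ℕ → Ω → List Bool → Update N → List Bool
  output : ℕ → Ω → List Bool → ℝ
  measurableSet_init : ∀ m, MeasurableSet {ω | init ω = m}
  measurableSet_step : ∀ t m u m', MeasurableSet {ω | step t ω m u = m'}
  measurable_output : ∀ t m, Measurable fun ω => output t ω m

namespace Algorithm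

variable {N : ℕ} {Ω : Type*} [MeasurableSpace Ω]

/-- The memory content after the first `n` updates of the stream `σ`. -/
def memory (A : Algorithm N Ω) (σ : ℕ → Update N) (ω : Ω) : ℕ → List Bool
  | 0 => A.init ω
  | n + 1 => A.step n ω (A.memory σ ω n) (σ n)

/-- The estimate that the algorithm maintains after the first `n` updates of `σ`. -/
def estimate (A : Algorithm N Ω) (σ : ℕ → Update N) (ω : Ω) (n : ℕ) : ℝ :=
  A.output n ω (A.memory σ ω n)

/-- `A` is an asymptotically exact algorithm for `F_k` under insertions and deletions, with failure
probability `δ`: on every infinite valid stream there is an error bound `ε n → 0` (which may depend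
on the stream) such that, for every `n`, the ratio of the estimate to the exact value `F_k` after
`n` updates is in `1 ± ε n` with probability at least `1 - δ`.
Nothing is required at times where `F_k = 0` and the ratio is undefined. -/
def AsymptoticallyExact (A : Algorithm N Ω) (μ : Measure Ω) (k : ℕ) (δ : ℝ) : Prop :=
  ∀ σ : ℕ → Update N, Valid σ →
    ∃ ε : ℕ → ℝ, Tendsto ε atTop (𝓝 0) ∧
      ∀ n, moment k σ n ≠ 0 →
        1 - δ ≤ μ.real {ω | |A.estimate σ ω n / moment k σ n - 1| ≤ ε n}

/-- After `n` updates of any valid stream the memory content of `A` almost surely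
has at most `s` bits. -/
def MemoryBound (A : Algorithm N Ω) (μ : Measure Ω) (n s : ℕ) : Prop :=
  ∀ σ : ℕ → Update N, Valid σ → ∀ᵐ ω ∂μ, (A.memory σ ω n).length ≤ s

end Algorithm

end DynamicStream

/-! Reduction from the one-way index problem. About `n / 2` bits are written as a set of present
elements, and the memory at time `n` is the message. To query a bit, one element is toggled forever:
at odd times `F_k` has one of two fixed values that differ by `2 ^ k - 2 ≥ 2`, so once the relative
error is small the estimate reveals the bit. That may happen very late, but the query costs no
communication, since the late memory is a function of the memory at time `n`, the query and the
coins (`memory_concat_add`, `exists_time`). Averaging fixes coins for which at most a fraction `δ`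
of all bits is decoded wrongly; a counting bound (`capacity_mul_le`) then makes the message linear
in `n`. -/

namespace DynamicStream

/-! ### Counting bound for decoding with errors -/

section Coding

/-- The bit strings of length at most `s`. -/
def boolLists : ℕ → Finset (List Bool)
  | 0 => {[]}
  | s + 1 => insert [] ((boolLists s).image (List.cons true) ∪ (boolLists s).image (List.cons false))

theorem mem_boolLists {l : List Bool} {s : ℕ} (h : l.length ≤ s) : l ∈ boolLists s := by
  induction s generalizing l with
  | zero => simpa [boolLists] using h
  | succ s ih =>
    cases l with
    | nil => simp [boolLists]
    | cons b l =>
      have := ih (l := l) (by simpa using h)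
      cases b <;> simp [boolLists, this]

theorem card_boolLists_lt (s : ℕ) : (boolLists s).card < 2 ^ (s + 1) := by
  induction s with
  | zero => simp [boolLists]
  | succ s ih =>
    have h1 := Finset.card_insert_le []
      ((boolLists s).image (List.cons true) ∪ (boolLists s).image (List.cons false))
    have h2 := Finset.card_union_le
      ((boolLists s).image (List.cons true)) ((boolLists s).image (List.cons false))
    have h3 : ((boolLists s).image (List.cons true)).card ≤ _ := Finset.card_image_le
    have h4 : ((boolLists s).image (List.cons false)).card ≤ _ := Finset.card_image_le
    rw [boolLists, pow_succ]
    omega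

/-- The generating function of the Hamming distances to a fixed point of the cube. -/
theorem sum_pow_hammingDist {m : ℕ} (y : Fin m → Bool) (t : ℝ) :
    ∑ x : Fin m → Bool, t ^ hammingDist y x = (1 + t) ^ m := by
  have h : ∀ x : Fin m → Bool, t ^ hammingDist y x = ∏ i, if y i ≠ x i then t else 1 := by
    intro x
    rw [Finset.prod_ite]
    simp [hammingDist]
  simp_rw [h]
  have := Finset.prod_univ_sum (fun _ : Fin m => (Finset.univ : Finset Bool))
    (fun i b => if y i ≠ b then t else 1)
  rw [Fintype.piFinset_univ] at this
  rw [← this]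
  have h2 : ∀ i, (∑ b : Bool, if y i ≠ b then t else 1) = 1 + t := by
    intro i
    cases y i <;> simp [add_comm]
  rw [Finset.prod_congr rfl fun i _ => h2 i]
  simp

/-- Average-case lower bound for one-way communication of a bit string: if an average fraction of
at most `δ` of the bits is decoded incorrectly from messages of at most `s` bits, then `s + 1` is at
least the capacity of the binary symmetric channel times the length. -/
theorem capacity_mul_le {m s : ℕ} {δ : ℝ} (hδ0 : 0 < δ) (hδ : δ < 1 / 2)
    (M : (Fin m → Bool) → List Bool) (hM : ∀ x, (M x).length ≤ s)
    (Y : List Bool → Fin m → Bool)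
    (h : ∑ x, (hammingDist (Y (M x)) x : ℝ) ≤ δ * m * 2 ^ m) :
    m * (Real.log 2 - Real.binEntropy δ) ≤ (s + 1) * Real.log 2 := by
  -- The weight `exp (-u) = δ / (1 - δ)` minimizes `u * δ + log (1 + exp (-u))`; the minimum is the
  -- binary entropy of `δ`.
  set u : ℝ := Real.log (1 - δ) - Real.log δ with hu
  have hu0 : 0 ≤ u := by
    have := Real.log_le_log hδ0 (show δ ≤ 1 - δ by linarith)
    linarith
  have ht : 1 + Real.exp (-u) = Real.exp (-Real.log (1 - δ)) := by
    have h1 : 0 < 1 - δ := by linarith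
    rw [hu, neg_sub, Real.exp_sub, Real.exp_neg, Real.exp_log hδ0, Real.exp_log h1]
    field_simp
    ring
  have upper : ∑ x, Real.exp (-u) ^ hammingDist (Y (M x)) x
      ≤ 2 ^ (s + 1) * (1 + Real.exp (-u)) ^ m := by
    calc ∑ x, Real.exp (-u) ^ hammingDist (Y (M x)) x
        ≤ ∑ x, ∑ l ∈ boolLists s, Real.exp (-u) ^ hammingDist (Y l) x := by
          refine Finset.sum_le_sum fun x _ => ?_
          exact Finset.single_le_sum (f := fun l => Real.exp (-u) ^ hammingDist (Y l) x)
            (fun l _ => by positivity) (mem_boolLists (hM x))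
      _ = ((boolLists s).card : ℝ) * (1 + Real.exp (-u)) ^ m := by
          rw [Finset.sum_comm]
          simp [sum_pow_hammingDist]
      _ ≤ _ := by
          gcongr
          exact_mod_cast (card_boolLists_lt s).le
  have lower : Real.exp (-u * (δ * m)) * 2 ^ m
      ≤ ∑ x, Real.exp (-u) ^ hammingDist (Y (M x)) x := by
    -- Tangent line of the exponential at `-u * (δ * m)`: it is linear in the distance, so the bound
    -- on the total distance suffices.
    have hx : ∀ x, Real.exp (-u * (δ * m)) * (1 + u * (δ * m) - u * hammingDist (Y (M x)) x)
        ≤ Real.exp (-u) ^ hammingDist (Y (M x)) x := by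
      intro x
      have := Real.add_one_le_exp (u * (δ * m) - u * hammingDist (Y (M x)) x)
      calc _ ≤ Real.exp (-u * (δ * m)) *
              Real.exp (u * (δ * m) - u * hammingDist (Y (M x)) x) := by
            gcongr; linarith
        _ = _ := by
            rw [← Real.exp_add, ← Real.exp_nat_mul]; ring_nf
    refine le_trans ?_ (Finset.sum_le_sum fun x _ => hx x)
    rw [← Finset.mul_sum, Finset.sum_sub_distrib, ← Finset.mul_sum]
    gcongr
    have := mul_le_mul_of_nonneg_left h hu0
    simp only [Finset.sum_const, Finset.card_univ, Fintype.card_fun, Fintype.card_bool,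
      Fintype.card_fin, nsmul_eq_mul]
    push_cast
    linarith
  have key := lower.trans upper
  rw [ht] at key
  have := Real.log_le_log (by positivity) key
  rw [Real.log_mul (by positivity) (by positivity), Real.log_mul (by positivity) (by positivity),
    Real.log_exp, Real.log_pow, Real.log_pow, Real.log_pow, Real.log_exp] at this
  push_cast at this
  rw [Real.binEntropy_eq_negMulLog_add_negMulLog_one_sub, Real.negMulLog, Real.negMulLog]
  rw [hu] at this
  linarith

end Coding

/-! ### The hard streams and their moments -/

section Streams

variable {N : ℕ}

/-- The stream that starts with the first `n` updates of `σ` and continues with `τ`. -/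
def concat (σ : ℕ → Update N) (n : ℕ) (τ : ℕ → Update N) (j : ℕ) : Update N :=
  if j < n then σ j else τ (j - n)

theorem freq_concat_of_le (σ τ : ℕ → Update N) {n t : ℕ} (h : t ≤ n) (a : Fin N) :
    freq (concat σ n τ) t a = freq σ t a := by
  refine Finset.sum_congr rfl fun j hj => ?_
  rw [concat, if_pos (lt_of_lt_of_le (Finset.mem_range.1 hj) h)]

theorem freq_concat_add (σ τ : ℕ → Update N) (n r : ℕ) (a : Fin N) :
    freq (concat σ n τ) (n + r) a = freq σ n a + freq τ r a := by
  rw [freq, Finset.sum_range_add, ← freq, freq_concat_of_le _ _ le_rfl]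
  simp [freq, concat]

theorem Valid.concat {σ τ : ℕ → Update N} (hσ : Valid σ) (hτ : Valid τ) (n : ℕ) :
    Valid (concat σ n τ) := by
  intro t a
  rcases le_total t n with h | h
  · rw [freq_concat_of_le _ _ h]; exact hσ t a
  · obtain ⟨r, rfl⟩ := Nat.exists_eq_add_of_le h
    rw [freq_concat_add]
    exact add_nonneg (hσ n a) (hτ r a)

/-- The stream that inserts and deletes `a` in turn. -/
def toggle (a : Fin N) (j : ℕ) : Update N := if Even j then .ins a else .del a

theorem freq_toggle (a b : Fin N) (r : ℕ) :
    freq (toggle a) r b = if b = a ∧ Odd r then 1 else 0 := by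
  induction r with
  | zero => simp [freq]
  | succ r ih =>
    rw [freq, Finset.sum_range_succ, ← freq, ih, toggle]
    rcases Nat.even_or_odd r with h | h
    · by_cases hb : b = a <;> simp [Update.delta, h, hb, Nat.not_odd_iff_even.2 h, h.add_one]
    · by_cases hb : b = a <;>
        simp [Update.delta, h, hb, Nat.not_even_iff_odd.2 h, Nat.not_odd_iff_even.2 h.add_one]

theorem valid_toggle (a : Fin N) : Valid (toggle a) := by
  intro n b
  rw [freq_toggle]
  split_ifs <;> simp

/-- The element that stands for the value `b` of bit number `j`. -/
def bitElement {m : ℕ} (h : 2 * m < N) (j : Fin m) (b : Bool) : Fin N :=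
  ⟨1 + 2 * j + b.toNat, by have := j.2; have := b.toNat_le; omega⟩

theorem bitElement_inj {m : ℕ} (h : 2 * m < N) {j j' : Fin m} {b b' : Bool} :
    bitElement h j b = bitElement h j' b' ↔ j = j' ∧ b = b' := by
  constructor
  · intro e
    have e' := congrArg Fin.val e
    have h1 := b.toNat_le
    have h2 := b'.toNat_le
    simp only [bitElement] at e'
    refine ⟨Fin.ext (by omega), ?_⟩
    cases b <;> cases b' <;> simp_all <;> omega
  · rintro ⟨rfl, rfl⟩; rfl

/-- The stream that inserts the elements that stand for the bits of `x`. -/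
def codeStream {m : ℕ} (h : 2 * m < N) (x : Fin m → Bool) (j : ℕ) : Update N :=
  if hj : j < m then .ins (bitElement h ⟨j, hj⟩ (x ⟨j, hj⟩)) else .ins ⟨0, by omega⟩

theorem freq_codeStream {m : ℕ} (h : 2 * m < N) (x : Fin m → Bool) (a : Fin N) :
    freq (codeStream h x) m a = ∑ j : Fin m, if a = bitElement h j (x j) then 1 else 0 := by
  rw [freq, Finset.sum_range]
  simp [codeStream, Update.delta]

theorem valid_codeStream {m : ℕ} (h : 2 * m < N) (x : Fin m → Bool) : Valid (codeStream h x) := by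
  intro n a
  refine Finset.sum_nonneg fun j _ => ?_
  unfold codeStream
  split_ifs <;> simp only [Update.delta] <;> split_ifs <;> simp

/-- The encoding of `x`, prolonged by toggling the element `0`. -/
def message {m : ℕ} (h : 2 * m < N) (x : Fin m → Bool) : ℕ → Update N :=
  concat (codeStream h x) m (toggle ⟨0, by omega⟩)

theorem valid_message {m : ℕ} (h : 2 * m < N) (x : Fin m → Bool) : Valid (message h x) :=
  (valid_codeStream h x).concat (valid_toggle _) m

theorem freq_codeStream_eq {m : ℕ} (h : 2 * m < N) (x : Fin m → Bool) (a : Fin N) :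
    freq (codeStream h x) m a = if ∃ j, a = bitElement h j (x j) then 1 else 0 := by
  rw [freq_codeStream]
  split_ifs with ha
  · obtain ⟨j, rfl⟩ := ha
    have hiff : ∀ j', (j = j' ∧ x j = x j') ↔ j = j' := fun j' =>
      ⟨fun hj => hj.1, fun hj => ⟨hj, hj ▸ rfl⟩⟩
    simp [bitElement_inj, hiff]
  · push Not at ha
    simp [ha]

/-- Bit elements start at `1`, so the padding element `0` never coincides with one of them. -/
theorem freq_message {m n : ℕ} (h : 2 * m < N) (hmn : m ≤ n) (x : Fin m → Bool) (a : Fin N) :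
    freq (message h x) n a = 0 ∨ freq (message h x) n a = 1 := by
  obtain ⟨r, rfl⟩ := Nat.exists_eq_add_of_le hmn
  rw [message, freq_concat_add, freq_codeStream_eq, freq_toggle]
  split_ifs with h1 h2 <;> simp
  obtain ⟨j, rfl⟩ := h1
  have := congrArg Fin.val h2.1
  simp only [bitElement] at this
  omega

theorem freq_message_bitElement {m n : ℕ} (h : 2 * m < N) (hmn : m ≤ n) (x : Fin m → Bool)
    (i : Fin m) : freq (message h x) n (bitElement h i false) = if x i then 0 else 1 := by
  obtain ⟨r, rfl⟩ := Nat.exists_eq_add_of_le hmn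
  have h0 : bitElement h i false ≠ ⟨0, by omega⟩ := by
    intro e
    have := congrArg Fin.val e
    simp only [bitElement] at this
    omega
  rw [message, freq_concat_add, freq_codeStream_eq, freq_toggle]
  cases hx : x i <;> simp [bitElement_inj, hx, h0]

/-- The number of elements present after the first `n` updates of a message. -/
def messageSize (m n : ℕ) : ℤ := m + if Odd (n - m) then 1 else 0

theorem sum_freq_message {m n : ℕ} (h : 2 * m < N) (hmn : m ≤ n) (x : Fin m → Bool) :
    ∑ a, freq (message h x) n a = messageSize m n := by
  obtain ⟨r, rfl⟩ := Nat.exists_eq_add_of_le hmn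
  simp only [message, freq_concat_add, freq_codeStream, freq_toggle, Finset.sum_add_distrib,
    messageSize, add_tsub_cancel_left]
  rw [Finset.sum_comm]
  by_cases hr : Odd r <;> simp [hr]

/-- The message that encodes `x`, followed by the query for bit number `i`. -/
def queryStream {m : ℕ} (h : 2 * m < N) (n : ℕ) (x : Fin m → Bool) (i : Fin m) : ℕ → Update N :=
  concat (message h x) n (toggle (bitElement h i false))

theorem valid_queryStream {m : ℕ} (h : 2 * m < N) (n : ℕ) (x : Fin m → Bool) (i : Fin m) :
    Valid (queryStream h n x i) :=
  (valid_message h x).concat (valid_toggle _) n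

/-- The frequency moment after a query whose answer is `b`. -/
def answer (k m n : ℕ) (b : Bool) : ℝ := messageSize m n + if b then 1 else 2 ^ k - 1

/-- The other multiplicities are `0` or `1`, hence equal to their `k`-th powers; the queried one
rises from `0` to `1` or from `1` to `2`. The value does not depend on `r`, which turns a small
relative error into a small absolute one. -/
theorem moment_queryStream {k m n : ℕ} (hk : k ≠ 0) (h : 2 * m < N) (hmn : m ≤ n)
    (x : Fin m → Bool) (i : Fin m) (r : ℕ) :
    moment k (queryStream h n x i) (n + (2 * r + 1)) = answer k m n (x i) := by
  have hterm : ∀ a, (freq (queryStream h n x i) (n + (2 * r + 1)) a : ℝ) ^ k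
      = freq (message h x) n a
        + if a = bitElement h i false then (if x i then 1 else 2 ^ k - 1) else 0 := by
    intro a
    rw [queryStream, freq_concat_add, freq_toggle]
    by_cases ha : a = bitElement h i false
    · subst ha
      rw [freq_message_bitElement h hmn]
      cases x i
      · norm_num
      · simp
    · rcases freq_message h hmn x a with hf | hf <;> simp [ha, hf, hk]
  rw [moment, Finset.sum_congr rfl fun a _ => hterm a, Finset.sum_add_distrib, answer,
    ← sum_freq_message h hmn x]
  simp

theorem answer_pos {k m n : ℕ} (hk : 2 ≤ k) (b : Bool) : 0 < answer k m n b := by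
  have h1 : (2 : ℝ) ^ 2 ≤ 2 ^ k := pow_le_pow_right₀ (by norm_num) hk
  have h2 : (0 : ℝ) ≤ messageSize m n := by
    have : 0 ≤ messageSize m n := by unfold messageSize; split_ifs <;> positivity
    exact_mod_cast this
  unfold answer
  split_ifs <;> linarith

end Streams

/-! ### From algorithms to the index problem -/

namespace Algorithm

variable {N : ℕ} {Ω : Type*} [MeasurableSpace Ω]

/-- The memory content after `r` updates of `τ`, starting at time `n` with memory content `l`. -/
def resume (A : Algorithm N Ω) (τ : ℕ → Update N) (ω : Ω) (n : ℕ) (l : List Bool) : ℕ → List Bool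
  | 0 => l
  | r + 1 => A.step (n + r) ω (A.resume τ ω n l r) (τ r)

theorem memory_concat_of_le (A : Algorithm N Ω) (σ τ : ℕ → Update N) (ω : Ω) {n t : ℕ}
    (h : t ≤ n) : A.memory (concat σ n τ) ω t = A.memory σ ω t := by
  induction t with
  | zero => rfl
  | succ t ih => rw [memory, memory, ih (by omega), concat, if_pos (by omega)]

/-- The past acts on the future only through the memory at time `n`, given the same coins. -/
theorem memory_concat_add (A : Algorithm N Ω) (σ τ : ℕ → Update N) (ω : Ω) (n r : ℕ) :
    A.memory (concat σ n τ) ω (n + r) = A.resume τ ω n (A.memory σ ω n) r := by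
  induction r with
  | zero => exact A.memory_concat_of_le σ τ ω le_rfl
  | succ r ih =>
    rw [← add_assoc, memory, ih, resume, concat, if_neg (by omega), Nat.add_sub_cancel_left]

/-- There are only countably many memory contents, so conditioning on the previous one gives a
countable union. -/
theorem measurableSet_memory (A : Algorithm N Ω) (σ : ℕ → Update N) (n : ℕ) (l : List Bool) :
    MeasurableSet {ω | A.memory σ ω n = l} := by
  induction n generalizing l with
  | zero => exact A.measurableSet_init l
  | succ n ih =>
    have : {ω | A.memory σ ω (n + 1) = l}
        = ⋃ l', {ω | A.memory σ ω n = l'} ∩ {ω | A.step n ω l' (σ n) = l} := by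
      ext ω
      simp [memory]
    rw [this]
    exact MeasurableSet.iUnion fun l' => (ih l').inter (A.measurableSet_step _ _ _ _)

theorem measurable_estimate (A : Algorithm N Ω) (σ : ℕ → Update N) (n : ℕ) :
    Measurable fun ω => A.estimate σ ω n := by
  intro S hS
  have : (fun ω => A.estimate σ ω n) ⁻¹' S
      = ⋃ l, {ω | A.memory σ ω n = l} ∩ (fun ω => A.output n ω l) ⁻¹' S := by
    ext ω
    simp [estimate]
  rw [this]
  exact MeasurableSet.iUnion fun l => (A.measurableSet_memory σ n l).inter (A.measurable_output n l hS)

open Classical in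
/-- The bits that are read off the memory content `l` at time `n` by running each query for
`2 * r + 1` further updates. -/
noncomputable def decode (A : Algorithm N Ω) (k : ℕ) {m : ℕ} (h : 2 * m < N) (n r : ℕ) (ω : Ω)
    (l : List Bool) (i : Fin m) : Bool :=
  decide (|A.output (n + (2 * r + 1)) ω
    (A.resume (toggle (bitElement h i false)) ω n l (2 * r + 1)) - answer k m n true| < 1)

theorem decode_eq (A : Algorithm N Ω) {k m n : ℕ} (hk : 2 ≤ k) (h : 2 * m < N) (r : ℕ) (ω : Ω)
    (x : Fin m → Bool) (i : Fin m)
    (hest : |A.estimate (queryStream h n x i) ω (n + (2 * r + 1)) - answer k m n (x i)| < 1) :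
    A.decode k h n r ω (A.memory (message h x) ω n) i = x i := by
  rw [estimate, queryStream, memory_concat_add] at hest
  rw [decode]
  cases hx : x i
  · rw [hx] at hest
    rw [decide_eq_false_iff_not, not_lt]
    -- The answers are at least `2` apart, so the open unit intervals around them are disjoint.
    have h1 : (2 : ℝ) ^ 2 ≤ 2 ^ k := pow_le_pow_right₀ (by norm_num) hk
    have h2 : answer k m n false - answer k m n true = 2 ^ k - 2 := by
      simp [answer]; ring
    have := (abs_lt.1 hest).1
    exact le_trans (by linarith) (le_abs_self _)
  · rw [hx] at hest
    simpa using hest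

/-- At a suitable late time every query is answered correctly with probability `1 - δ`. -/
theorem AsymptoticallyExact.exists_time {A : Algorithm N Ω} {μ : Measure Ω}
    {k : ℕ} {δ : ℝ} (hA : A.AsymptoticallyExact μ k δ) [IsProbabilityMeasure μ] (hk : 2 ≤ k)
    {m n : ℕ} (h : 2 * m < N) (hmn : m ≤ n) :
    ∃ r, ∀ (x : Fin m → Bool) (i : Fin m), 1 - δ ≤ μ.real
      {ω | |A.estimate (queryStream h n x i) ω (n + (2 * r + 1)) - answer k m n (x i)| < 1} := by
  have ht : Tendsto (fun r : ℕ => n + (2 * r + 1)) atTop atTop :=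
    tendsto_atTop_mono (fun r => by simp only [id]; omega) tendsto_id
  have hev : ∀ x : Fin m → Bool, ∀ i : Fin m, ∀ᶠ r in atTop, 1 - δ ≤ μ.real
      {ω | |A.estimate (queryStream h n x i) ω (n + (2 * r + 1)) - answer k m n (x i)| < 1} := by
    intro x i
    obtain ⟨ε, hε, hprob⟩ := hA _ (valid_queryStream h n x i)
    have hF := answer_pos (m := m) (n := n) hk (x i)
    filter_upwards [(hε.comp ht).eventually_lt_const (one_div_pos.2 hF)] with r hr
    have hmom := moment_queryStream (k := k) (by omega) h hmn x i r
    refine (hprob (n + (2 * r + 1)) (by rw [hmom]; exact hF.ne')).trans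
      (measureReal_mono fun ω hω => ?_)
    rw [Set.mem_ofPred_eq, hmom] at hω
    have hlt := hω.trans_lt hr
    rw [div_sub_one hF.ne', abs_div, abs_of_pos hF, div_lt_div_iff_of_pos_right hF] at hlt
    exact hlt
  -- The error bound depends on the stream, but there are finitely many pairs `x`, `i`. The decoder
  -- does not know `x`, so `r` must not depend on it.
  exact (eventually_all.2 fun x => eventually_all.2 fun i => hev x i).exists

/-- The memory of an asymptotically exact algorithm solves the index problem. -/
theorem AsymptoticallyExact.capacity_mul_le {A : Algorithm N Ω} {μ : Measure Ω}
    {k : ℕ} {δ : ℝ} (hA : A.AsymptoticallyExact μ k δ) [IsProbabilityMeasure μ] (hk : 2 ≤ k)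
    (hδ0 : 0 < δ) (hδ : δ < 1 / 2) {m n s : ℕ} (h : 2 * m < N) (hmn : m ≤ n)
    (hs : A.MemoryBound μ n s) :
    m * (Real.log 2 - Real.binEntropy δ) ≤ (s + 1) * Real.log 2 := by
  obtain ⟨r, hr⟩ := hA.exists_time hk h hmn
  set E : (Fin m → Bool) → Fin m → Set Ω := fun x i =>
    {ω | |A.estimate (queryStream h n x i) ω (n + (2 * r + 1)) - answer k m n (x i)| < 1} with hE
  have hmeas : ∀ x i, MeasurableSet (E x i) := fun x i =>
    measurableSet_lt ((A.measurable_estimate _ _).sub_const _).abs measurable_const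
  set f : Ω → ℝ := fun ω => ∑ x, ∑ i, (E x i)ᶜ.indicator 1 ω with hf
  have hint : ∀ x i, Integrable ((E x i)ᶜ.indicator (1 : Ω → ℝ)) μ := fun x i =>
    (integrable_const (1 : ℝ)).indicator (hmeas x i).compl
  have hfint : Integrable f μ :=
    integrable_finsetSum _ fun x _ => integrable_finsetSum _ fun i _ => hint x i
  have hfle : ∫ ω, f ω ∂μ ≤ δ * m * 2 ^ m := by
    rw [hf, integral_finsetSum _ fun x _ => integrable_finsetSum _ fun i _ => hint x i]
    calc ∑ x, ∫ ω, ∑ i, (E x i)ᶜ.indicator 1 ω ∂μ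
        ≤ ∑ _x : Fin m → Bool, ∑ _i : Fin m, δ := by
          refine Finset.sum_le_sum fun x _ => ?_
          rw [integral_finsetSum _ fun i _ => hint x i]
          refine Finset.sum_le_sum fun i _ => ?_
          rw [integral_indicator_one (hmeas x i).compl, probReal_compl_eq_one_sub (hmeas x i)]
          linarith [hr x i]
      _ = _ := by simp; ring
  have hae : ∀ᵐ ω ∂μ, ∀ x, (A.memory (message h x) ω n).length ≤ s :=
    ae_all_iff.2 fun x => hs _ (valid_message h x)
  -- One `ω` satisfies every length bound and has no more errors than the average.
  obtain ⟨ω, hω, hωf⟩ := exists_notMem_null_le_integral hfint (ae_iff.1 hae)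
  simp only [Set.mem_ofPred_eq, not_not] at hω
  refine DynamicStream.capacity_mul_le hδ0 hδ (fun x => A.memory (message h x) ω n) hω
    (A.decode k h n r ω) (le_trans (Finset.sum_le_sum fun x _ => ?_) (hωf.trans hfle))
  rw [hammingDist, Finset.card_filter]
  push_cast
  refine Finset.sum_le_sum fun i _ => ?_
  by_cases hi : ω ∈ E x i
  · rw [if_neg (not_not.2 (A.decode_eq hk h r ω x i hi))]
    exact Set.indicator_nonneg (fun _ _ => zero_le_one) _
  · rw [Set.indicator_of_mem (Set.mem_compl hi)]
    split_ifs <;> simp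

end Algorithm

end DynamicStream

/-! ### Choice of constants -/

theorem mainTheorem3 (k : ℕ) (hk : 2 ≤ k) (δ : ℝ) (hδ0 : 0 < δ) (hδ : δ < 1 / 2) :
    ∃ c : ℝ, 0 < c ∧ ∃ n₀ : ℕ, ∀ n N : ℕ, n₀ ≤ n → n ≤ N →
      ∀ (Ω : Type*) [MeasurableSpace Ω] (μ : Measure Ω) [IsProbabilityMeasure μ]
        (A : DynamicStream.Algorithm N Ω), A.AsymptoticallyExact μ k δ →
        ∀ s : ℕ, A.MemoryBound μ n s → c * (n : ℝ) ≤ (s : ℝ) := by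
  have hlog : 0 < Real.log 2 := Real.log_pos (by norm_num)
  have hH : Real.binEntropy δ < Real.log 2 :=
    Real.binEntropy_lt_log_two.2 (by rw [← one_div]; exact hδ.ne)
  obtain ⟨κ, hκ⟩ : ∃ κ, κ = (Real.log 2 - Real.binEntropy δ) / Real.log 2 := ⟨_, rfl⟩
  have hκ0 : 0 < κ := hκ ▸ div_pos (by linarith) hlog
  -- With `m = (n - 1) / 2`, the bounds `m * κ ≤ s + 1` and `n ≤ 2 * m + 2` give `n * κ ≤ 2 * s + 2
  -- * (κ + 1)`; for `n ≥ n₀` the last term is at most `n * κ / 2`.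
  refine ⟨κ / 4, by positivity, ⌈4 * (κ + 1) / κ⌉₊ + 1, ?_⟩
  intro n N hn hnN Ω _ μ _ A hA s hs
  have hcap := hA.capacity_mul_le (m := (n - 1) / 2) hk hδ0 hδ (by omega) (by omega) hs
  have hm : (((n - 1) / 2 : ℕ) : ℝ) * κ ≤ s + 1 := by
    rw [hκ, ← mul_div_assoc, div_le_iff₀ hlog]
    exact hcap
  have hmn : (n : ℝ) ≤ 2 * ((n - 1) / 2 : ℕ) + 2 := by
    have : n ≤ 2 * ((n - 1) / 2) + 2 := by omega
    exact_mod_cast this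
  have hlarge : 4 * (κ + 1) ≤ n * κ := by
    rw [← div_le_iff₀ hκ0]
    exact (Nat.le_ceil _).trans (by exact_mod_cast (by omega : ⌈4 * (κ + 1) / κ⌉₊ ≤ n))
  nlinarith [mul_le_mul_of_nonneg_right hmn hκ0.le]
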